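/- Let $p$ be an odd prime and let $s \ge p+1$ be an integer. For a group $G$ write $\gamma_1(G)=G$, $\gamma_{k+1}(G)=[\gamma_k(G),G]$; let $G^p$ be the subgroup generated by the $p$-th powers of elements of $G$; let $\Omega_{\{1\}}(G)=\{g\in G : g^p=1\}$ and let $\Omega_1(G)$ be the subgroup generated by $\Omega_{\{1\}}(G)$. Let $M$ be the free $\mathbb{Z}_p$-module with basis $x_1,\dots,x_{p-1}$, let $\alpha$ be the $\mathbb{Z}_p$-linear map of $M$ with $\alpha(x_i)=x_{i+1}$ for $i\le p-2$ and $\alpha(x_{p-1})=-(x_1+\dots+x_{p-1})$, and put $M_1=M$, $M_r=(\alpha-1)M_{r-1}$ for $r\ge 2$. Then there is a finite $p$-group $G$ such that 1. $|G|=p^s$; 2. $G$ is of maximal class, that is, its nilpotency class is $s-1$; 3. $|G:G^p\gamma_{p-1}(G)|=|\Omega_1(G)|$, and also $|G:G^p\gamma_{p-1}(G)|=|\Omega_{\{1\}}(G)|$; 4. $\gamma_{p-1}(G)\not\le G^p$; 5. $G$ is a non-split extension $1\to M/M_s\to G\to C_p\to 1$ in which some $y\in G$ mapping to a generator of $C_p$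 acts on $M/M_s$ by conjugation ($x\mapsto y^{-1}xy$) as $\alpha$, and $y^p$ is a generator of $M_{s-1}/M_s$. In particular, the conditions "$\gamma_k(G)\le G^{p^i}$" and "$|G:G^{p^i}\gamma_k(G)|=|\{g\in G: g^{p^i}=1\}|$" on a finite $p$-group $G$ are not equivalent in general for $k=p-1$, $i=1$. -/

import Mathlib

open scoped Padic

/-- The term `γ_k(G)` of the lower central series, with `γ_1(G) = G` (used only for `k ≥ 1`). -/
def gammaTerm (G : Type*) [Group G] (k : ℕ) : Subgroup G :=
  Subgroup.lowerCentralSeries (⊤ : Subgroup G) (k - 1)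

/-- `G^n`, the subgroup generated by the `n`-th powers of the elements of `G`. -/
def powerSubgroup (G : Type*) [Group G] (n : ℕ) : Subgroup G :=
  Subgroup.closure (Set.range fun g : G => g ^ n)

/-- The set `Ω_{i}(G)` of elements whose order divides `p ^ i`. -/
def omegaSet (p i : ℕ) (G : Type*) [Group G] : Set G :=
  {g | g ^ p ^ i = 1}

/-- The subgroup `Ω_i(G)` generated by the elements whose order divides `p ^ i`. -/
def omegaSubgroup (p i : ℕ) (G : Type*) [Group G] : Subgroup G :=
  Subgroup.closure (omegaSet p i G)

/-- A finite `p`-group of maximal class: order `p ^ n` with `n ≥ 2`, and nilpotency class `n - 1`. -/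
def IsMaximalClass (p : ℕ) (G : Type*) [Group G] : Prop :=
  ∃ n : ℕ, 2 ≤ n ∧ Nat.card G = p ^ n ∧ Group.IsNilpotent G ∧ Group.nilpotencyClass G = n - 1

/-- The `ℤ_p`-lattice `M` of rank `p - 1`; its basis `x_1, …, x_{p-1}` is the standard basis. -/
abbrev UniserialLattice (p : ℕ) [Fact p.Prime] : Type :=
  Fin (p - 1) → ℤ_[p]

/-- The map `α` with `α(x_i) = x_{i+1}` for `i ≤ p - 2` and
`α(x_{p-1}) = -(x_1 + ⋯ + x_{p-1})` (in additive notation). -/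
noncomputable def latticeAlpha (p : ℕ) [Fact p.Prime] : UniserialLattice p →ₗ[ℤ_[p]] UniserialLattice p :=
  (Pi.basisFun ℤ_[p] (Fin (p - 1))).constr ℤ_[p] fun i =>
    if h : (i : ℕ) + 1 < p - 1 then Pi.basisFun ℤ_[p] (Fin (p - 1)) ⟨(i : ℕ) + 1, h⟩
    else -∑ j, Pi.basisFun ℤ_[p] (Fin (p - 1)) j

/-- The sublattices `M_1 = M` and `M_r = [M_{r-1}, α]`, the image of `M_{r-1}` under `α - 1`
(with `M_0 = M` by convention). -/
noncomputable def latticeSeries (p : ℕ) [Fact p.Prime] : ℕ → Submodule ℤ_[p] (UniserialLattice p)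
  | 0 => ⊤
  | 1 => ⊤
  | r + 2 => (latticeSeries p (r + 1)).map (latticeAlpha p - LinearMap.id)

/-- `G` is a non-split extension `1 → M / M_r → G → C_p → 1`, where some lift `y ∈ G` of a
generator of `C_p` acts on `M / M_r` (by `x ↦ y⁻¹ x y`) as `α`, and `y ^ p` is a generator of
`M_{r-1} / M_r`. -/
def IsNonsplitLatticeExtension (p : ℕ) [Fact p.Prime] (r : ℕ) (G : Type*) [Group G] : Prop :=
  ∃ (S : GroupExtension (Multiplicative (UniserialLattice p ⧸ latticeSeries p r)) G
      (Multiplicative (ZMod p))) (y : G) (z : UniserialLattice p ⧸ latticeSeries p r),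
    IsEmpty S.Splitting ∧
    S.rightHom y = Multiplicative.ofAdd 1 ∧
    (∀ x : UniserialLattice p,
      y⁻¹ * S.inl (Multiplicative.ofAdd ((latticeSeries p r).mkQ x)) * y =
        S.inl (Multiplicative.ofAdd ((latticeSeries p r).mkQ (latticeAlpha p x)))) ∧
    Submodule.span ℤ_[p] {z} = (latticeSeries p (r - 1)).map (latticeSeries p r).mkQ ∧
    y ^ p = S.inl (Multiplicative.ofAdd z)

/-! Put δ = α − 1 and A = M/M_s. The norm 1 + α + ⋯ + α^(p−1) vanishes on M, so δ is a root of the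
Eisenstein polynomial Φ_p(X + 1), whence δ^(p−1)M = pM (`range_latticeDelta_pow`). The coordinate
sum mod p shows |M : δM| = p, and injectivity of δ then gives |M : δ^k M| = p^k.

G is A × ℤ/p with the product twisted by α and by the carry cocycle times z, where z spans
M_(s−1)/M_s. Its commutators give γ_(n+1)(G) = δ^n A for n ≥ 1 (`lowerCentralSeries_succ_eq`), hence
maximal class. Since the norm vanishes, the p-th power of an element outside A is a nonzero multiple
of z (`pow_prime`). So the extension does not split, and the elements with g^p = 1 form exactly the
kernel of p on A, of order |A : pA| = p^(p−1). As s ≥ p + 1, z lies in pA, so G^p = pA = δ^(p−1)A.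
This is strictly inside γ_(p−1)(G) = δ^(p−2)A, whose index in G is p · p^(p−2). -/

open scoped commutatorElement

/-! ### Extensions of ℤ/p built from the carry cocycle -/

/-- The data of an extension of `ℤ/p` by an `R`-module `A`: the action `α` of a lift of the
generator, and the `p`-th power `z` of this lift. -/
structure CyclicExtensionData (p : ℕ) (R A : Type*) [CommRing R] [AddCommGroup A]
    [Module R A] where
  α : Module.End R A
  z : A
  pow_eq_one : α ^ p = 1
  map_z : α z = z

namespace CyclicExtensionData

variable {p : ℕ} {R A : Type*} [CommRing R] [AddCommGroup A] [Module R A]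

/-- The underlying type of the extension; `⟨a, i⟩` stands for `y ^ i * a`. -/
@[ext]
structure Ext (D : CyclicExtensionData p R A) where
  left : A
  right : ZMod p

variable (D : CyclicExtensionData p R A)

/-- The action of `ℤ/p` through powers of `α`. -/
def act (i : ZMod p) : Module.End R A := D.α ^ i.val

/-- The carry in the addition of the standard representatives of two residues. -/
def carry (i j : ZMod p) : ℕ := (i.val + j.val) / p

/-- Both sides count the carries in a sum of three residues, the floor of (a + b + c)/p. This
cocycle identity is what makes the product associative. -/
theorem carry_add_carry [NeZero p] (i j k : ZMod p) :
    carry i j + carry (i + j) k = carry j k + carry i (j + k) := by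
  have hp : 0 < p := Nat.pos_of_neZero p
  unfold carry
  rw [ZMod.val_add, ZMod.val_add]
  generalize i.val = a, j.val = b, k.val = c
  have h1 : (a + b) / p + ((a + b) % p + c) / p = (a + b + c) / p := by
    conv_rhs => rw [← Nat.div_add_mod (a + b) p, add_assoc, Nat.mul_add_div hp]
  have h2 : (b + c) / p + (a + (b + c) % p) / p = (a + b + c) / p := by
    conv_rhs => rw [add_assoc, ← Nat.div_add_mod (b + c) p, add_left_comm, Nat.mul_add_div hp]
  rw [h1, h2]

theorem carry_zero_left [NeZero p] (i : ZMod p) : carry 0 i = 0 := by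
  simp [carry, Nat.div_eq_of_lt (ZMod.val_lt i)]

theorem carry_zero_right [NeZero p] (i : ZMod p) : carry i 0 = 0 := by
  simp [carry, Nat.div_eq_of_lt (ZMod.val_lt i)]

theorem carry_comm (i j : ZMod p) : carry i j = carry j i := by
  rw [carry, carry, add_comm]

theorem act_zero : D.act 0 = 1 := by simp [act]

theorem pow_mod (n : ℕ) : D.α ^ (n % p) = D.α ^ n := by
  conv_rhs => rw [← Nat.mod_add_div n p, pow_add, pow_mul, D.pow_eq_one, one_pow, mul_one]

theorem act_add [NeZero p] (i j : ZMod p) : D.act (i + j) = D.act i * D.act j := by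
  rw [act, act, act, ZMod.val_add, D.pow_mod, pow_add]

theorem act_natCast (n : ℕ) : D.act (n : ZMod p) = D.α ^ n := by
  rw [act, ZMod.val_natCast, D.pow_mod]

theorem act_apply_act [NeZero p] (i j : ZMod p) (a : A) :
    D.act i (D.act j a) = D.act (i + j) a := by
  rw [D.act_add]; rfl

theorem pow_apply_z (n : ℕ) : (D.α ^ n) D.z = D.z := by
  induction n with
  | zero => rfl
  | succ n ih => rw [pow_succ, Module.End.mul_apply, D.map_z, ih]

theorem act_z (i : ZMod p) : D.act i D.z = D.z := D.pow_apply_z _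

namespace Ext

variable {D}

instance : Mul D.Ext := ⟨fun g h =>
  ⟨D.act h.right g.left + h.left + carry g.right h.right • D.z, g.right + h.right⟩⟩

instance : One D.Ext := ⟨⟨0, 0⟩⟩

instance : Inv D.Ext := ⟨fun g =>
  ⟨-D.act (-g.right) g.left - carry (-g.right) g.right • D.z, -g.right⟩⟩

theorem mul_left (g h : D.Ext) :
    (g * h).left = D.act h.right g.left + h.left + carry g.right h.right • D.z := rfl

theorem mul_right (g h : D.Ext) : (g * h).right = g.right + h.right := rfl

theorem one_left : (1 : D.Ext).left = 0 := rfl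

theorem one_right : (1 : D.Ext).right = 0 := rfl

theorem inv_left (g : D.Ext) :
    g⁻¹.left = -D.act (-g.right) g.left - carry (-g.right) g.right • D.z := rfl

theorem inv_right (g : D.Ext) : g⁻¹.right = -g.right := rfl

instance [NeZero p] : Group D.Ext := Group.ofLeftAxioms
  (by
    intro g h k
    ext
    · simp only [mul_left, mul_right, map_add, map_nsmul, D.act_z, D.act_apply_act]
      have h1 := congrArg (· • D.z) (carry_add_carry g.right h.right k.right)
      simp only [add_smul] at h1
      rw [add_comm h.right k.right] at *
      calc _ = D.act (k.right + h.right) g.left + D.act k.right h.left + k.left +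
            (carry g.right h.right • D.z + carry (g.right + h.right) k.right • D.z) := by abel
        _ = _ := by rw [h1]; abel
    · exact add_assoc _ _ _)
  (by
    intro g
    ext
    · simp [mul_left, one_left, one_right, carry_zero_left]
    · simp [mul_right, one_right])
  (by
    intro g
    ext
    · simp only [mul_left, inv_left, inv_right, one_left, map_sub, map_neg, map_nsmul, D.act_z,
        D.act_apply_act, add_neg_cancel, D.act_zero, Module.End.one_apply]
      abel
    · simp [mul_right, inv_right, one_right])

/-- The inclusion of the kernel. -/
def inl (D : CyclicExtensionData p R A) [NeZero p] : Multiplicative A →* D.Ext where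
  toFun a := ⟨a.toAdd, 0⟩
  map_one' := rfl
  map_mul' a b := by
    ext
    · simp [mul_left, D.act_zero, carry_zero_left]
    · simp [mul_right]

/-- The projection to the quotient. -/
def rightHom (D : CyclicExtensionData p R A) [NeZero p] :
    D.Ext →* Multiplicative (ZMod p) where
  toFun g := Multiplicative.ofAdd g.right
  map_one' := rfl
  map_mul' _ _ := rfl

/-- The group extension attached to the data. -/
def extension (D : CyclicExtensionData p R A) [NeZero p] :
    GroupExtension (Multiplicative A) D.Ext (Multiplicative (ZMod p)) where
  inl := inl D
  rightHom := rightHom D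
  inl_injective _ _ h := congrArg (fun g : D.Ext => Multiplicative.ofAdd g.left) h
  range_inl_eq_ker_rightHom := by
    ext g
    constructor
    · rintro ⟨a, rfl⟩
      rfl
    · intro h
      exact ⟨Multiplicative.ofAdd g.left, Ext.ext rfl (congrArg Multiplicative.toAdd h).symm⟩
  rightHom_surjective i := ⟨⟨0, i.toAdd⟩, rfl⟩

/-- The chosen lift of the generator of the quotient. -/
def y (D : CyclicExtensionData p R A) : D.Ext := ⟨0, 1⟩

variable [NeZero p]

theorem inl_left (a : Multiplicative A) : (inl D a).left = a.toAdd := rfl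

theorem inl_right (a : Multiplicative A) : (inl D a).right = 0 := rfl

theorem conj_y (a : A) :
    (y D)⁻¹ * inl D (Multiplicative.ofAdd a) * y D = inl D (Multiplicative.ofAdd (D.α a)) := by
  have h1 : D.act 1 = D.α := by
    have := D.act_natCast 1
    rwa [Nat.cast_one, pow_one] at this
  rw [mul_assoc, inv_mul_eq_iff_eq_mul]
  ext
  · simp [mul_left, inl_left, inl_right, y, h1, carry_zero_left, carry_zero_right]
  · simp [mul_right, inl_right, y]

theorem pow_right (g : D.Ext) (n : ℕ) : (g ^ n).right = n * g.right := by
  induction n with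
  | zero => simp [one_right]
  | succ n ih => rw [pow_succ, mul_right, ih]; push_cast; ring

theorem pow_left (g : D.Ext) (n : ℕ) :
    (g ^ n).left = ∑ k ∈ Finset.range n, D.act (k * g.right) g.left +
      (n * g.right.val / p) • D.z := by
  induction n with
  | zero => simp [one_left]
  | succ n ih =>
    -- The successive carries accumulate to a single floor.
    have hc : n * g.right.val / p + carry ((n : ZMod p) * g.right) g.right =
        (n + 1) * g.right.val / p := by
      have hp : 0 < p := Nat.pos_of_neZero p
      have hv : ((n : ZMod p) * g.right).val = (n * g.right.val) % p := by
        rw [← ZMod.val_natCast]; simp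
      rw [carry, hv, add_mul, one_mul]
      conv_rhs => rw [← Nat.div_add_mod (n * g.right.val) p, add_assoc, Nat.mul_add_div hp]
    rw [pow_succ, mul_left, ih, pow_right, ← hc, Finset.sum_range_succ', add_smul]
    simp only [map_add, map_sum, map_nsmul, D.act_z, D.act_apply_act, Nat.cast_zero, zero_mul,
      D.act_zero, Module.End.one_apply, Nat.cast_succ]
    have : ∀ k : ℕ, g.right + (k : ZMod p) * g.right = ((k : ZMod p) + 1) * g.right := fun k => by ring
    simp only [this]
    abel

/-! ### Subgroups of the kernel and the lower central series -/

/-- The subgroup of the kernel given by a submodule. -/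
def embed (D : CyclicExtensionData p R A) (B : Submodule R A) : Subgroup D.Ext where
  carrier := {g | g.right = 0 ∧ g.left ∈ B}
  mul_mem' := by
    rintro g h ⟨hg, hg'⟩ ⟨hh, hh'⟩
    refine ⟨by rw [mul_right, hg, hh, add_zero], ?_⟩
    rw [mul_left, hg, hh, D.act_zero, carry_zero_left, zero_smul, add_zero]
    exact B.add_mem hg' hh'
  one_mem' := ⟨rfl, B.zero_mem⟩
  inv_mem' := by
    rintro g ⟨hg, hg'⟩
    refine ⟨by rw [inv_right, hg, neg_zero], ?_⟩
    rw [inv_left, hg, neg_zero, D.act_zero, carry_zero_left, zero_smul, sub_zero]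
    exact B.neg_mem hg'

theorem mem_embed {B : Submodule R A} {g : D.Ext} :
    g ∈ embed D B ↔ g.right = 0 ∧ g.left ∈ B := Iff.rfl

theorem inl_mem_embed {B : Submodule R A} {a : A} :
    inl D (Multiplicative.ofAdd a) ∈ embed D B ↔ a ∈ B :=
  ⟨fun h => h.2, fun h => ⟨rfl, h⟩⟩

theorem embed_le_embed {B C : Submodule R A} : embed D B ≤ embed D C ↔ B ≤ C :=
  ⟨fun h _ ha => inl_mem_embed.1 (h (inl_mem_embed.2 ha)), fun h _ hg => ⟨hg.1, h hg.2⟩⟩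

theorem embed_bot : embed D ⊥ = ⊥ := by
  refine le_antisymm (fun g hg => ?_) bot_le
  exact Ext.ext hg.2 hg.1

theorem card_embed (B : Submodule R A) : Nat.card (embed D B) = Nat.card B :=
  Nat.card_congr
    { toFun := fun g => ⟨g.1.left, g.2.2⟩
      invFun := fun b => ⟨⟨b.1, 0⟩, rfl, b.2⟩
      left_inv := fun g => Subtype.ext (Ext.ext rfl g.2.1.symm)
      right_inv := fun _ => rfl }

/-- The underlying set of the extension is a product. -/
def equivProd (D : CyclicExtensionData p R A) : D.Ext ≃ A × ZMod p where
  toFun g := (g.left, g.right)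
  invFun x := ⟨x.1, x.2⟩
  left_inv _ := rfl
  right_inv _ := rfl

omit [NeZero p] in
theorem card_eq : Nat.card D.Ext = Nat.card A * p := by
  rw [Nat.card_congr (equivProd D), Nat.card_prod, Nat.card_zmod]

instance [Finite A] : Finite D.Ext := Finite.of_equiv _ (equivProd D).symm

theorem index_embed [Finite A] (B : Submodule R A) :
    (embed D B).index = p * B.toAddSubgroup.index := by
  have h1 := (embed D B).card_mul_index
  have h2 := B.toAddSubgroup.card_mul_index
  rw [card_embed, card_eq, ← h2, mul_assoc, mul_comm _ p] at h1
  exact Nat.eq_of_mul_eq_mul_left (Nat.card_pos (α := B)) h1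

/-- The carry is symmetric, so z cancels: commutators depend only on the action. -/
theorem mul_eq_mul_swap (g h : D.Ext) :
    g * h = h * g * inl D (Multiplicative.ofAdd
      ((D.act h.right g.left - g.left) - (D.act g.right h.left - h.left))) := by
  ext
  · simp only [mul_left, mul_right, inl_left, inl_right, D.act_zero, carry_zero_right, toAdd_ofAdd,
      Module.End.one_apply, carry_comm h.right, zero_smul]
    abel
  · simp only [mul_right, inl_right, add_zero, add_comm]

omit [NeZero p] in
theorem act_sub_mem {B : Submodule R A} (hB : ∀ a ∈ B, D.α a ∈ B) (i : ZMod p) {a : A}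
    (ha : a ∈ B) : D.act i a - a ∈ B.map (D.α - 1) := by
  rw [act]
  have hmem : ∀ n : ℕ, (D.α ^ n) a ∈ B := by
    intro n
    induction n with
    | zero => exact ha
    | succ n ih => rw [pow_succ']; exact hB _ ih
  induction i.val with
  | zero => simp
  | succ n ih =>
    have : (D.α ^ (n + 1)) a - a = (D.α - 1) ((D.α ^ n) a) + ((D.α ^ n) a - a) := by
      rw [pow_succ']; simp
    rw [this]
    exact Submodule.add_mem _ (Submodule.mem_map_of_mem (hmem n)) ih

omit [NeZero p] in
theorem map_sub_one_le {B : Submodule R A} (hB : ∀ a ∈ B, D.α a ∈ B) :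
    B.map (D.α - 1) ≤ B := by
  rintro _ ⟨a, ha, rfl⟩
  exact B.sub_mem (hB a ha) ha

theorem normal_embed {B : Submodule R A} (hB : ∀ a ∈ B, D.α a ∈ B) : (embed D B).Normal := by
  refine ⟨fun n hn g => ?_⟩
  have h1 : g * n * g⁻¹ = n * inl D (Multiplicative.ofAdd (D.act g⁻¹.right n.left - n.left)) := by
    have h2 := mul_eq_mul_swap n g⁻¹
    rw [hn.1, D.act_zero, Module.End.one_apply, sub_self, sub_zero] at h2
    rw [mul_assoc, h2]
    group
  rw [h1]
  exact mul_mem hn (inl_mem_embed.2 (map_sub_one_le hB (act_sub_mem hB _ hn.2)))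

omit [NeZero p] in
theorem mem_of_sub_one_map {B : Submodule R A} (hB : ∀ a ∈ B, D.α a ∈ B) :
    ∀ a ∈ B.map (D.α - 1), D.α a ∈ B.map (D.α - 1) := by
  rintro _ ⟨a, ha, rfl⟩
  exact ⟨D.α a, hB a ha, by simp⟩

/-- The two conditions replace membership of g and h in the kernel, so that the same bound serves
for [B, G] and for [G, G]. -/
theorem commutatorElement_mem {B : Submodule R A} (hB : ∀ a ∈ B, D.α a ∈ B) {g h : D.Ext}
    (hg : D.act h.right g.left - g.left ∈ B.map (D.α - 1))
    (hh : D.act g.right h.left - h.left ∈ B.map (D.α - 1)) :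
    ⁅g, h⁆ ∈ embed D (B.map (D.α - 1)) := by
  have h1 : ⁅g, h⁆ = h * g * inl D (Multiplicative.ofAdd
      ((D.act h.right g.left - g.left) - (D.act g.right h.left - h.left))) * (h * g)⁻¹ := by
    rw [commutatorElement_def, mul_assoc, ← mul_inv_rev]
    exact congrArg (· * (h * g)⁻¹) (mul_eq_mul_swap g h)
  rw [h1]
  exact (normal_embed (mem_of_sub_one_map hB)).conj_mem _
    (inl_mem_embed.2 (Submodule.sub_mem _ hg hh)) _

theorem commutator_embed_top {B : Submodule R A} (hB : ∀ a ∈ B, D.α a ∈ B) :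
    ⁅embed D B, ⊤⁆ = embed D (B.map (D.α - 1)) := by
  apply le_antisymm
  · rw [Subgroup.commutator_le]
    intro g hg h _
    refine commutatorElement_mem hB (act_sub_mem hB _ hg.2) ?_
    rw [hg.1, D.act_zero, Module.End.one_apply, sub_self]
    exact Submodule.zero_mem _
  · rintro g ⟨hg, b, hb, hgb⟩
    -- Commutators with the one element y⁻¹ already exhaust the image of α − 1.
    have h1 : g = ⁅(y D)⁻¹, inl D (Multiplicative.ofAdd b)⁆ := by
      rw [commutatorElement_def, inv_inv, conj_y, ← map_inv, ← map_mul]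
      refine Ext.ext ?_ hg
      rw [← hgb, inl_left]
      simp [sub_eq_add_neg]
    rw [h1, Subgroup.commutator_comm]
    exact Subgroup.commutator_mem_commutator (Subgroup.mem_top _) (inl_mem_embed.2 hb)

theorem commutator_top_top :
    ⁅(⊤ : Subgroup D.Ext), (⊤ : Subgroup D.Ext)⁆ = embed D (LinearMap.range (D.α - 1)) := by
  rw [← Submodule.map_top]
  apply le_antisymm
  · rw [Subgroup.commutator_le]
    intro g _ h _
    exact commutatorElement_mem (fun _ _ => Submodule.mem_top)
      (act_sub_mem (fun _ _ => Submodule.mem_top) _ Submodule.mem_top)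
      (act_sub_mem (fun _ _ => Submodule.mem_top) _ Submodule.mem_top)
  · rw [← commutator_embed_top (D := D) (B := ⊤) fun _ _ => Submodule.mem_top]
    exact Subgroup.commutator_mono le_top le_rfl

/-- The formula starts at n + 1 because G itself is not inside the kernel; this lost factor of p is
why the class is one less than the exponent of |G|. -/
theorem lowerCentralSeries_succ_eq (n : ℕ) :
    (⊤ : Subgroup D.Ext).lowerCentralSeries (n + 1) =
      embed D (LinearMap.range ((D.α - 1) ^ (n + 1))) := by
  induction n with
  | zero => rw [zero_add, pow_one]; exact commutator_top_top
  | succ n ih =>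
    rw [Subgroup.lowerCentralSeries_succ, ih, commutator_embed_top, pow_succ' _ (n + 1),
      Module.End.mul_eq_comp, LinearMap.range_comp]
    rintro _ ⟨a, rfl⟩
    have hc : Commute D.α ((D.α - 1) ^ (n + 1)) :=
      ((Commute.refl D.α).sub_right (Commute.one_right _)).pow_right _
    exact ⟨D.α a, by rw [← Module.End.mul_apply, ← hc.eq, Module.End.mul_apply]⟩

theorem lowerCentralSeries_eq {n : ℕ} (hn : 0 < n) :
    (⊤ : Subgroup D.Ext).lowerCentralSeries n = embed D (LinearMap.range ((D.α - 1) ^ n)) := by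
  obtain ⟨m, rfl⟩ := Nat.exists_eq_add_one.2 hn
  exact lowerCentralSeries_succ_eq m

theorem pow_inl (a : Multiplicative A) (n : ℕ) :
    inl D a ^ n = inl D (Multiplicative.ofAdd (n • a.toAdd)) := by
  rw [← map_pow]; rfl

/-! ### Powers, elements of order p, and non-splitting -/

variable [Fact p.Prime]

/-- If the norm of `α` vanishes, the `p`-th powers outside the kernel only depend on the
projection. -/
theorem pow_prime (hnorm : ∑ k ∈ Finset.range p, D.α ^ k = 0) {g : D.Ext} (hg : g.right ≠ 0) :
    g ^ p = inl D (Multiplicative.ofAdd (g.right.val • D.z)) := by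
  ext
  · rw [pow_left, Nat.mul_div_cancel_left _ (Nat.pos_of_neZero p), inl_left, toAdd_ofAdd]
    convert zero_add _
    have h1 : ∀ f : ZMod p → A, ∑ k ∈ Finset.range p, f k = ∑ j : ZMod p, f j := by
      intro f
      refine Finset.sum_bij (fun k _ => (k : ZMod p)) (fun _ _ => Finset.mem_univ _) ?_ ?_
        (fun _ _ => rfl)
      · intro a ha b hb hab
        have := congrArg ZMod.val hab
        rwa [ZMod.val_natCast_of_lt (Finset.mem_range.1 ha),
          ZMod.val_natCast_of_lt (Finset.mem_range.1 hb)] at this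
      · intro j _
        exact ⟨j.val, Finset.mem_range.2 (ZMod.val_lt j), ZMod.natCast_zmod_val j⟩
    rw [h1 fun j => D.act (j * g.right) g.left]
    refine (Equiv.sum_comp (Equiv.mulRight₀ g.right hg) fun j => D.act j g.left).trans ?_
    rw [← h1 fun j => D.act j g.left]
    simp only [D.act_natCast]
    rw [← LinearMap.sum_apply, hnorm, LinearMap.zero_apply]
  · rw [pow_right, inl_right, CharP.cast_eq_zero, zero_mul]

theorem val_smul_z_ne_zero (hz : D.z ≠ 0) (hpz : p • D.z = 0) {i : ZMod p} (hi : i ≠ 0) :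
    i.val • D.z ≠ 0 := by
  intro h
  have h1 := addOrderOf_eq_prime hpz hz
  have h2 := addOrderOf_dvd_of_nsmul_eq_zero h
  rw [h1] at h2
  exact hi ((ZMod.val_eq_zero i).1 (Nat.eq_zero_of_dvd_of_lt h2 (ZMod.val_lt i)))

theorem omegaSet_eq (hnorm : ∑ k ∈ Finset.range p, D.α ^ k = 0) (hz : D.z ≠ 0)
    (hpz : p • D.z = 0) :
    omegaSet p 1 D.Ext = embed D (LinearMap.ker (p : Module.End R A)) := by
  ext g
  rw [omegaSet, Set.mem_ofPred_eq, pow_one, SetLike.mem_coe, mem_embed, LinearMap.mem_ker]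
  constructor
  · intro h
    have hg : g.right = 0 := by
      by_contra hg
      rw [pow_prime hnorm hg] at h
      exact val_smul_z_ne_zero hz hpz hg (congrArg Ext.left h)
    refine ⟨hg, ?_⟩
    have h1 : g = inl D (Multiplicative.ofAdd g.left) := Ext.ext rfl hg
    rw [h1, pow_inl] at h
    rw [Module.End.natCast_apply]
    exact congrArg Ext.left h
  · rintro ⟨h, h'⟩
    have h1 : g = inl D (Multiplicative.ofAdd g.left) := Ext.ext rfl h
    rw [h1, pow_inl]
    rw [Module.End.natCast_apply] at h'
    exact Ext.ext h' rfl

theorem powerSubgroup_eq (hnorm : ∑ k ∈ Finset.range p, D.α ^ k = 0)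
    (hz : D.z ∈ LinearMap.range (p : Module.End R A)) :
    powerSubgroup D.Ext p = embed D (LinearMap.range (p : Module.End R A)) := by
  apply le_antisymm
  · rw [powerSubgroup, Subgroup.closure_le]
    rintro _ ⟨g, rfl⟩
    dsimp only
    rw [SetLike.mem_coe]
    by_cases hg : g.right = 0
    · have h1 : g = inl D (Multiplicative.ofAdd g.left) := Ext.ext rfl hg
      rw [h1, pow_inl]
      exact inl_mem_embed.2 ⟨g.left, by simp⟩
    · rw [pow_prime hnorm hg]
      exact inl_mem_embed.2 (Submodule.smul_of_tower_mem _ _ hz)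
  · rintro g ⟨hg, a, ha⟩
    refine Subgroup.subset_closure ⟨inl D (Multiplicative.ofAdd a), ?_⟩
    dsimp only
    rw [pow_inl]
    refine Ext.ext ?_ hg.symm
    rw [← ha, inl_left]
    simp

/-- A section would send the generator to a lift with trivial p-th power, but every such lift has
p-th power z. -/
theorem isEmpty_splitting (hnorm : ∑ k ∈ Finset.range p, D.α ^ k = 0) (hz : D.z ≠ 0) :
    IsEmpty (extension D).Splitting := by
  refine ⟨fun f => ?_⟩
  have hr : (f (Multiplicative.ofAdd 1)).right = 1 :=
    congrArg Multiplicative.toAdd (f.rightHom_splitting (Multiplicative.ofAdd 1))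
  have h1 : f (Multiplicative.ofAdd 1) ^ p = 1 := by
    rw [← map_pow, ← ofAdd_nsmul]
    simp
  rw [pow_prime hnorm (by rw [hr]; exact one_ne_zero), hr, ZMod.val_one, one_smul] at h1
  exact hz (congrArg Ext.left h1)

end Ext
end CyclicExtensionData

/-! ### The lattice M and the Eisenstein relation -/

section Lattice

variable (p : ℕ) [Fact p.Prime]

/-- The endomorphism `α - 1` of the lattice. -/
noncomputable def latticeDelta : Module.End ℤ_[p] (UniserialLattice p) := latticeAlpha p - 1

/-- The first basis vector of the lattice. -/
noncomputable def latticeGen : UniserialLattice p :=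
  Pi.basisFun ℤ_[p] (Fin (p - 1)) ⟨0, Nat.sub_pos_of_lt (Fact.out : p.Prime).one_lt⟩

theorem latticeSeries_succ (r : ℕ) :
    latticeSeries p (r + 1) = LinearMap.range (latticeDelta p ^ r) := by
  induction r with
  | zero => rw [latticeSeries, pow_zero, Module.End.one_eq_id, LinearMap.range_id]
  | succ r ih =>
    rw [latticeSeries, ih, pow_succ', Module.End.mul_eq_comp, LinearMap.range_comp]
    rfl

theorem latticeAlpha_basis (i : Fin (p - 1)) :
    latticeAlpha p (Pi.basisFun ℤ_[p] (Fin (p - 1)) i) =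
      if h : (i : ℕ) + 1 < p - 1 then Pi.basisFun ℤ_[p] (Fin (p - 1)) ⟨(i : ℕ) + 1, h⟩
      else -∑ j, Pi.basisFun ℤ_[p] (Fin (p - 1)) j :=
  Module.Basis.constr_basis _ _ _ _

theorem latticeAlpha_pow_gen (k : ℕ) (hk : k < p - 1) :
    (latticeAlpha p ^ k) (latticeGen p) = Pi.basisFun ℤ_[p] (Fin (p - 1)) ⟨k, hk⟩ := by
  induction k with
  | zero => rfl
  | succ k ih =>
    rw [pow_succ', Module.End.mul_apply, ih (by omega), latticeAlpha_basis, dif_pos hk]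

theorem sum_latticeAlpha_pow_gen :
    (∑ k ∈ Finset.range p, latticeAlpha p ^ k) (latticeGen p) = 0 := by
  have hp := (Fact.out : p.Prime).two_le
  have h1 : (latticeAlpha p ^ (p - 1)) (latticeGen p) =
      -∑ j, Pi.basisFun ℤ_[p] (Fin (p - 1)) j := by
    obtain ⟨m, hm⟩ : ∃ m, p - 1 = m + 1 := ⟨p - 2, by omega⟩
    have h2 : (latticeAlpha p ^ (m + 1)) (latticeGen p) =
        -∑ j, Pi.basisFun ℤ_[p] (Fin (p - 1)) j := by
      rw [pow_succ', Module.End.mul_apply, latticeAlpha_pow_gen p m (by omega),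
        latticeAlpha_basis, dif_neg]
      simp [hm]
    rwa [← hm] at h2
  have h3 : Finset.range p = Finset.range (p - 1 + 1) := by
    congr 1
    omega
  rw [h3, Finset.sum_range_succ, LinearMap.add_apply, h1, LinearMap.sum_apply,
    Finset.sum_range, ← sub_eq_add_neg, sub_eq_zero]
  exact Finset.sum_congr rfl fun i _ => latticeAlpha_pow_gen p i i.2

/-- The norm commutes with α and kills x_1, whose α-translates span M. -/
theorem sum_latticeAlpha_pow : ∑ k ∈ Finset.range p, latticeAlpha p ^ k = 0 := by
  refine (Pi.basisFun ℤ_[p] (Fin (p - 1))).ext fun i => ?_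
  rw [← latticeAlpha_pow_gen p i i.2, ← Module.End.mul_apply]
  have hc : Commute (∑ k ∈ Finset.range p, latticeAlpha p ^ k) (latticeAlpha p ^ (i : ℕ)) :=
    (Commute.sum_left _ _ _ fun k _ => (Commute.refl _).pow_pow k i)
  rw [hc.eq, Module.End.mul_apply, sum_latticeAlpha_pow_gen, map_zero, LinearMap.zero_apply]

/-- On a fixed vector the vanishing norm acts as multiplication by p, and M is torsion-free. -/
theorem latticeDelta_injective : Function.Injective (latticeDelta p) := by
  rw [← LinearMap.ker_eq_bot, LinearMap.ker_eq_bot']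
  intro x hx
  have h1 : latticeAlpha p x = x := by
    rwa [latticeDelta, LinearMap.sub_apply, Module.End.one_apply, sub_eq_zero] at hx
  have h2 : ∀ k : ℕ, (latticeAlpha p ^ k) x = x := by
    intro k
    induction k with
    | zero => rfl
    | succ k ih => rw [pow_succ', Module.End.mul_apply, ih, h1]
  have h3 := LinearMap.congr_fun (sum_latticeAlpha_pow p) x
  rw [LinearMap.sum_apply, Finset.sum_congr rfl fun k _ => h2 k, Finset.sum_const,
    Finset.card_range, LinearMap.zero_apply] at h3
  funext i
  have h4 : (p : ℤ_[p]) * x i = 0 := by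
    have := congrFun h3 i
    simpa using this
  exact (mul_eq_zero.1 h4).resolve_left (Nat.cast_ne_zero.2 (Fact.out : p.Prime).ne_zero)

open Polynomial in
/-- The Eisenstein form of the shifted cyclotomic polynomial. -/
theorem exists_cyclotomic_comp_eq : ∃ h : ℤ[X],
    (cyclotomic p ℤ).comp (X + 1) = X ^ (p - 1) + C (p : ℤ) * (1 + X * h) := by
  have hp := (Fact.out : p.Prime)
  set f : ℤ[X] := (cyclotomic p ℤ).comp (X + 1) with hf
  have hX : (X + 1 : ℤ[X]) = X + C 1 := by simp
  have hmonic : f.Monic := by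
    rw [hf, hX]; exact (cyclotomic.monic p ℤ).comp_X_add_C 1
  have hdeg : f.natDegree = p - 1 := by
    rw [hf, hX, natDegree_comp, natDegree_X_add_C, mul_one, natDegree_cyclotomic,
      Nat.totient_prime hp]
  have heis : f.IsEisensteinAt (Ideal.span {(p : ℤ)}) := cyclotomic_comp_X_add_one_isEisensteinAt p
  have hdvd : C (p : ℤ) ∣ f - X ^ (p - 1) := by
    rw [C_dvd_iff_dvd_coeff]
    intro n
    rw [coeff_sub, coeff_X_pow]
    rcases lt_trichotomy n (p - 1) with h | h | h
    · rw [if_neg h.ne, sub_zero]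
      exact Ideal.mem_span_singleton.1 (heis.mem (by rwa [hdeg]))
    · have : f.coeff n = 1 := by rw [h, ← hdeg]; exact hmonic
      rw [this, if_pos h, sub_self]
      exact dvd_zero _
    · rw [if_neg h.ne', coeff_eq_zero_of_natDegree_lt (by rwa [hdeg]), sub_zero]
      exact dvd_zero _
  obtain ⟨g, hg⟩ := hdvd
  have hg0 : g.coeff 0 = 1 := by
    have h1 := congrArg (eval 0) hg
    have h2 : p - 1 ≠ 0 := by have := hp.two_le; omega
    simp only [hf, eval_sub, eval_comp, eval_add, eval_X, eval_one, zero_add,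
      eval_one_cyclotomic_prime, eval_pow, zero_pow h2, sub_zero, eval_mul, eval_C] at h1
    rw [← coeff_zero_eq_eval_zero] at h1
    exact mul_left_cancel₀ (Int.natCast_ne_zero.2 hp.ne_zero) (by rw [← h1, mul_one])
  refine ⟨g.divX, ?_⟩
  have h3 := X_mul_divX_add g
  rw [hg0, C_1, add_comm] at h3
  rw [h3, ← hg]
  ring

theorem exists_latticeDelta_pow_eq : ∃ h : Module.End ℤ_[p] (UniserialLattice p),
    latticeDelta p ^ (p - 1) + (p : Module.End ℤ_[p] (UniserialLattice p)) *
      (1 + latticeDelta p * h) = 0 := by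
  obtain ⟨h, hh⟩ := exists_cyclotomic_comp_eq p
  have h1 := congrArg (Polynomial.aeval (latticeDelta p)) hh
  refine ⟨Polynomial.aeval (latticeDelta p) h, ?_⟩
  rw [Polynomial.aeval_comp, Polynomial.cyclotomic_prime] at h1
  simp only [map_add, map_sum, map_pow, map_mul, map_one, Polynomial.aeval_X,
    map_natCast] at h1
  rw [← h1, latticeDelta]
  simp only [sub_add_cancel]
  exact sum_latticeAlpha_pow p

/-- If `d ^ m` agrees with `-n` up to terms in `n d`, then `n` is divisible by `d ^ m` up to
terms in `n d ^ k`. -/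
theorem natCast_eq_pow_mul_add {S : Type*} [Ring S] {d h : S} {m n : ℕ}
    (hh : d ^ m + (n : S) * (1 + d * h) = 0) (k : ℕ) :
    ∃ u v : S, (n : S) = d ^ m * u + d ^ k * (v * n) := by
  induction k with
  | zero => exact ⟨0, 1, by simp⟩
  | succ k ih =>
    obtain ⟨u, v, huv⟩ := ih
    -- Obtained by rewriting v n with the relation once, which trades it for a multiple of d^m plus
    -- d times a multiple of n.
    refine ⟨u - d ^ k * v, -(h * v), ?_⟩
    have h1 : v * (n : S) = -(d ^ m * v) + d * (-(h * v) * n) := by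
      rw [eq_neg_of_add_eq_zero_left hh, ← Nat.cast_comm n v, neg_mul, neg_neg, mul_assoc,
        add_mul, one_mul, mul_add, neg_mul, mul_neg, ← Nat.cast_comm n (h * v),
        ← mul_assoc d, ← Nat.cast_comm n d]
      simp only [mul_assoc, add_neg_cancel_right]
    conv_lhs => rw [huv, h1]
    rw [mul_add, mul_neg, ← mul_assoc (d ^ k), ← mul_assoc (d ^ k), ← pow_succ, ← pow_add,
      add_comm k, pow_add, mul_sub, mul_assoc (d ^ m)]
    abel

theorem range_latticeDelta_pow : LinearMap.range (latticeDelta p ^ (p - 1)) =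
    LinearMap.range (p : Module.End ℤ_[p] (UniserialLattice p)) := by
  obtain ⟨h, hh⟩ := exists_latticeDelta_pow_eq p
  apply le_antisymm
  · rintro _ ⟨x, rfl⟩
    refine ⟨-((1 + latticeDelta p * h) x), ?_⟩
    rw [map_neg, ← Module.End.mul_apply, eq_neg_of_add_eq_zero_left hh, LinearMap.neg_apply]
  -- Stopping at k = p − 1 makes both terms divisible by δ^(p−1), so 1 + δh need not be inverted.
  · obtain ⟨u, v, huv⟩ := natCast_eq_pow_mul_add hh (p - 1)
    rintro _ ⟨x, rfl⟩
    refine ⟨(u + v * p) x, ?_⟩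
    rw [← Module.End.mul_apply, mul_add, ← huv]

/-! ### Indices and generators of the filtration -/

/-- The augmentation modulo `p`. -/
noncomputable def latticeAug : UniserialLattice p →+ ZMod p where
  toFun x := ∑ i, PadicInt.toZMod (x i)
  map_zero' := by simp
  map_add' x y := by simp [Finset.sum_add_distrib]

theorem latticeAug_smul (c : ℤ_[p]) (x : UniserialLattice p) :
    latticeAug p (c • x) = PadicInt.toZMod c * latticeAug p x := by
  simp [latticeAug, Finset.mul_sum]

theorem latticeAug_basis (i : Fin (p - 1)) :
    latticeAug p (Pi.basisFun ℤ_[p] (Fin (p - 1)) i) = 1 := by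
  simp only [latticeAug, AddMonoidHom.coe_mk, ZeroHom.coe_mk, Pi.basisFun_apply, Pi.single_apply]
  simp [apply_ite]

theorem latticeAug_alpha (x : UniserialLattice p) :
    latticeAug p (latticeAlpha p x) = latticeAug p x := by
  conv_lhs => rw [← (Pi.basisFun ℤ_[p] (Fin (p - 1))).sum_repr x]
  conv_rhs => rw [← (Pi.basisFun ℤ_[p] (Fin (p - 1))).sum_repr x]
  simp only [map_sum, map_smul, latticeAug_smul]
  refine Finset.sum_congr rfl fun i _ => ?_
  rw [latticeAug_basis, latticeAlpha_basis]
  split_ifs with h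
  · rw [latticeAug_basis]
  · rw [map_neg, map_sum, Finset.sum_congr rfl fun j _ => latticeAug_basis p j]
    -- The last basis vector maps to augmentation −(p − 1), which is 1 mod p.
    have := (Fact.out : p.Prime).one_le
    simp [Nat.cast_sub this]

theorem basis_sub_gen_mem (i : ℕ) (hi : i < p - 1) :
    Pi.basisFun ℤ_[p] (Fin (p - 1)) ⟨i, hi⟩ - latticeGen p ∈ LinearMap.range (latticeDelta p) := by
  rw [← latticeAlpha_pow_gen]
  have h1 : latticeAlpha p ^ i - 1 = latticeDelta p * ∑ k ∈ Finset.range i, latticeAlpha p ^ k :=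
    (mul_geom_sum _ _).symm
  exact ⟨_, (LinearMap.congr_fun h1 (latticeGen p)).symm⟩

theorem sub_smul_gen_mem (x : UniserialLattice p) :
    x - (∑ i, x i) • latticeGen p ∈ LinearMap.range (latticeDelta p) := by
  have h1 : x - (∑ i, x i) • latticeGen p =
      ∑ i, x i • (Pi.basisFun ℤ_[p] (Fin (p - 1)) i - latticeGen p) := by
    simp only [smul_sub, Finset.sum_sub_distrib, Finset.sum_smul]
    congr 1
    exact ((Pi.basisFun ℤ_[p] (Fin (p - 1))).sum_repr x).symm
  rw [h1]
  exact Submodule.sum_mem _ fun i _ => Submodule.smul_mem _ _ (basis_sub_gen_mem p i i.2)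

theorem ker_latticeAug :
    (latticeAug p).ker = (LinearMap.range (latticeDelta p)).toAddSubgroup := by
  ext x
  constructor
  · intro hx
    have h1 : PadicInt.toZMod (∑ i, x i) = 0 := by
      rw [map_sum]; exact hx
    rw [← RingHom.mem_ker, PadicInt.ker_toZMod, PadicInt.maximalIdeal_eq_span_p,
      Ideal.mem_span_singleton] at h1
    obtain ⟨c, hc⟩ := h1
    have h2 := sub_smul_gen_mem p x
    -- The coordinate sum is divisible by p, and pM = δ^(p−1)M lies in δM.
    have h3 : (∑ i, x i) • latticeGen p ∈ LinearMap.range (latticeDelta p) := by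
      obtain ⟨y, hy⟩ : (∑ i, x i) • latticeGen p ∈
          LinearMap.range (latticeDelta p ^ (p - 1)) := by
        rw [range_latticeDelta_pow, hc]
        refine ⟨c • latticeGen p, ?_⟩
        rw [Module.End.natCast_apply, mul_smul, Nat.cast_smul_eq_nsmul]
      rw [← hy, ← mul_pow_sub_one (Nat.sub_ne_zero_of_lt (Fact.out : p.Prime).one_lt)]
      exact ⟨_, rfl⟩
    have h4 := Submodule.add_mem _ h2 h3
    rwa [sub_add_cancel] at h4
  · rintro ⟨y, rfl⟩
    rw [AddMonoidHom.mem_ker, latticeDelta, LinearMap.sub_apply, map_sub, latticeAug_alpha,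
      Module.End.one_apply, sub_self]

theorem latticeAug_gen : latticeAug p (latticeGen p) = 1 := latticeAug_basis p _

theorem index_range_latticeDelta :
    (LinearMap.range (latticeDelta p)).toAddSubgroup.index = p := by
  rw [← ker_latticeAug, AddSubgroup.index_ker]
  have h1 : (latticeAug p).range = ⊤ := by
    rw [AddMonoidHom.range_eq_top]
    intro a
    refine ⟨a.val • latticeGen p, ?_⟩
    rw [map_nsmul, latticeAug_gen]
    simp
  rw [h1]
  simp

theorem index_range_latticeDelta_pow (k : ℕ) :
    (LinearMap.range (latticeDelta p ^ k)).toAddSubgroup.index = p ^ k := by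
  induction k with
  | zero =>
    rw [pow_zero, pow_zero, Module.End.one_eq_id, LinearMap.range_id]
    exact AddSubgroup.index_top
  | succ k ih =>
    have h1 : (LinearMap.range (latticeDelta p ^ (k + 1))).toAddSubgroup =
        (LinearMap.range (latticeDelta p ^ k)).toAddSubgroup.map
          (latticeDelta p).toAddMonoidHom := by
      rw [pow_succ', Module.End.mul_eq_comp, LinearMap.range_comp]
      rfl
    rw [h1, AddSubgroup.index_map_of_injective _ (latticeDelta_injective p), ih]
    exact congrArg (p ^ k * ·) (index_range_latticeDelta p)

theorem latticeDelta_pow_gen_notMem (k : ℕ) :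
    (latticeDelta p ^ k) (latticeGen p) ∉ LinearMap.range (latticeDelta p ^ (k + 1)) := by
  rintro ⟨x, hx⟩
  rw [pow_succ, Module.End.mul_apply] at hx
  have h1 : latticeDelta p x = latticeGen p := by
    have hinj : Function.Injective (latticeDelta p ^ k) := by
      rw [Module.End.coe_pow]
      exact (latticeDelta_injective p).iterate k
    exact hinj hx
  have h2 : latticeGen p ∈ (latticeAug p).ker := by
    rw [ker_latticeAug]
    exact ⟨x, h1⟩
  rw [AddMonoidHom.mem_ker, latticeAug_gen] at h2
  exact one_ne_zero h2

theorem range_latticeDelta_pow_eq_sup (k : ℕ) :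
    LinearMap.range (latticeDelta p ^ k) =
      Submodule.span ℤ_[p] {(latticeDelta p ^ k) (latticeGen p)} ⊔
        LinearMap.range (latticeDelta p ^ (k + 1)) := by
  apply le_antisymm
  · rintro _ ⟨x, rfl⟩
    have h1 : (latticeDelta p ^ k) x = (∑ i, x i) • (latticeDelta p ^ k) (latticeGen p) +
        (latticeDelta p ^ k) (x - (∑ i, x i) • latticeGen p) := by simp
    rw [h1]
    refine Submodule.add_mem_sup (Submodule.smul_mem _ _ (Submodule.mem_span_singleton_self _)) ?_
    obtain ⟨w, hw⟩ := sub_smul_gen_mem p x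
    exact ⟨w, by rw [← hw, pow_succ]; rfl⟩
  · refine sup_le ?_ ?_
    · rw [Submodule.span_singleton_le_iff_mem]
      exact ⟨_, rfl⟩
    · rintro _ ⟨x, rfl⟩
      exact ⟨latticeDelta p x, by rw [pow_succ]; rfl⟩

end Lattice

theorem LinearMap.range_pow_anti {R A : Type*} [Semiring R] [AddCommMonoid A] [Module R A]
    (f : Module.End R A) {k l : ℕ} (h : k ≤ l) :
    LinearMap.range (f ^ l) ≤ LinearMap.range (f ^ k) := by
  rw [← Nat.add_sub_cancel' h, pow_add, Module.End.mul_eq_comp]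
  exact LinearMap.range_comp_le_range _ _

theorem index_map_mkQ {R A : Type*} [Ring R] [AddCommGroup A] [Module R A]
    {N B : Submodule R A} (h : N ≤ B) :
    (B.map N.mkQ).toAddSubgroup.index = B.toAddSubgroup.index := by
  have h1 : N.mkQ.toAddMonoidHom.ker ≤ B.toAddSubgroup := fun x hx =>
    h ((Submodule.Quotient.mk_eq_zero N).1 hx)
  have h2 : (B.map N.mkQ).toAddSubgroup = B.toAddSubgroup.map N.mkQ.toAddMonoidHom := rfl
  rw [h2]
  exact AddSubgroup.index_map_eq _ N.mkQ_surjective h1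

/-! ### The finite quotients M/M_s and the element z -/

section QuotientExtension

variable (p : ℕ) [Fact p.Prime] (s : ℕ)

theorem latticeSeries_le_comap : latticeSeries p s ≤ (latticeSeries p s).comap (latticeAlpha p) := by
  rcases s with _ | r
  · exact le_top
  · rw [latticeSeries_succ]
    rintro _ ⟨x, rfl⟩
    have hc : Commute (latticeAlpha p) (latticeDelta p ^ r) :=
      ((Commute.refl (latticeAlpha p)).sub_right (Commute.one_right _)).pow_right r
    exact ⟨latticeAlpha p x, by rw [← Module.End.mul_apply, ← hc.eq, Module.End.mul_apply]⟩

/-- The endomorphism of `M / M_s` induced by `α`. -/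
noncomputable def quotientAlpha : Module.End ℤ_[p] (UniserialLattice p ⧸ latticeSeries p s) :=
  (latticeSeries p s).mapQ _ (latticeAlpha p) (latticeSeries_le_comap p s)

theorem quotientAlpha_mkQ (x : UniserialLattice p) :
    quotientAlpha p s ((latticeSeries p s).mkQ x) = (latticeSeries p s).mkQ (latticeAlpha p x) :=
  Submodule.mapQ_apply _ _ _ _

theorem quotientAlpha_pow_mkQ (k : ℕ) (x : UniserialLattice p) :
    (quotientAlpha p s ^ k) ((latticeSeries p s).mkQ x) =
      (latticeSeries p s).mkQ ((latticeAlpha p ^ k) x) := by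
  induction k with
  | zero => rfl
  | succ k ih =>
    rw [pow_succ', Module.End.mul_apply, ih, quotientAlpha_mkQ, pow_succ', Module.End.mul_apply]

theorem quotientDelta_pow_mkQ (k : ℕ) (x : UniserialLattice p) :
    ((quotientAlpha p s - 1) ^ k) ((latticeSeries p s).mkQ x) =
      (latticeSeries p s).mkQ ((latticeDelta p ^ k) x) := by
  induction k with
  | zero => rfl
  | succ k ih =>
    rw [pow_succ', Module.End.mul_apply, ih, LinearMap.sub_apply, quotientAlpha_mkQ,
      Module.End.one_apply, ← map_sub, pow_succ', Module.End.mul_apply]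
    rfl

theorem range_quotientDelta_pow (k : ℕ) :
    LinearMap.range ((quotientAlpha p s - 1) ^ k) =
      (LinearMap.range (latticeDelta p ^ k)).map (latticeSeries p s).mkQ := by
  have h1 : ((quotientAlpha p s - 1) ^ k) ∘ₗ (latticeSeries p s).mkQ =
      (latticeSeries p s).mkQ ∘ₗ (latticeDelta p ^ k) :=
    LinearMap.ext (quotientDelta_pow_mkQ p s k)
  rw [← LinearMap.range_comp, ← h1,
    LinearMap.range_comp_of_range_eq_top _ (Submodule.range_mkQ _)]

theorem sum_quotientAlpha_pow : ∑ k ∈ Finset.range p, quotientAlpha p s ^ k = 0 := by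
  refine LinearMap.ext fun a => ?_
  obtain ⟨x, rfl⟩ := (latticeSeries p s).mkQ_surjective a
  rw [LinearMap.sum_apply, Finset.sum_congr rfl fun k _ => quotientAlpha_pow_mkQ p s k x,
    ← map_sum, ← LinearMap.sum_apply, sum_latticeAlpha_pow]
  simp

theorem quotientAlpha_pow_prime : quotientAlpha p s ^ p = 1 := by
  rw [← sub_eq_zero, ← geom_sum_mul, sum_quotientAlpha_pow, zero_mul]

theorem range_quotientDelta_pow_prime :
    LinearMap.range ((quotientAlpha p s - 1) ^ (p - 1)) =
      LinearMap.range (p : Module.End ℤ_[p] (UniserialLattice p ⧸ latticeSeries p s)) := by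
  have h1 : (p : Module.End ℤ_[p] (UniserialLattice p ⧸ latticeSeries p s)) ∘ₗ
      (latticeSeries p s).mkQ = (latticeSeries p s).mkQ ∘ₗ
        (p : Module.End ℤ_[p] (UniserialLattice p)) :=
    LinearMap.ext fun x => by
      rw [LinearMap.comp_apply, LinearMap.comp_apply, Module.End.natCast_apply,
        Module.End.natCast_apply, map_nsmul]
  rw [range_quotientDelta_pow, range_latticeDelta_pow, ← LinearMap.range_comp, ← h1,
    LinearMap.range_comp_of_range_eq_top _ (Submodule.range_mkQ _)]

theorem quotientDelta_pow_eq_zero (r : ℕ) : (quotientAlpha p (r + 1) - 1) ^ r = 0 := by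
  rw [← LinearMap.range_eq_bot, range_quotientDelta_pow, ← latticeSeries_succ,
    Submodule.mkQ_map_self]

theorem card_quotient_latticeSeries (r : ℕ) :
    Nat.card (UniserialLattice p ⧸ latticeSeries p (r + 1)) = p ^ r := by
  have h := index_range_latticeDelta_pow p r
  rwa [← latticeSeries_succ] at h

instance finite_quotient_latticeSeries (r : ℕ) :
    Finite (UniserialLattice p ⧸ latticeSeries p (r + 1)) := by
  refine Nat.finite_of_card_ne_zero ?_
  rw [card_quotient_latticeSeries]
  exact pow_ne_zero _ (Fact.out : p.Prime).ne_zero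

theorem index_range_quotientDelta_pow {k r : ℕ} (h : k ≤ r) :
    (LinearMap.range ((quotientAlpha p (r + 1) - 1) ^ k)).toAddSubgroup.index = p ^ k := by
  rw [range_quotientDelta_pow, index_map_mkQ, index_range_latticeDelta_pow]
  rw [latticeSeries_succ]
  exact LinearMap.range_pow_anti _ h

theorem not_range_quotientDelta_pow_le {k l r : ℕ} (h : k < l) (hl : k < r) :
    ¬ LinearMap.range ((quotientAlpha p (r + 1) - 1) ^ k) ≤
      LinearMap.range ((quotientAlpha p (r + 1) - 1) ^ l) := by
  intro hle
  have h1 : LinearMap.range ((quotientAlpha p (r + 1) - 1) ^ k) =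
      LinearMap.range ((quotientAlpha p (r + 1) - 1) ^ (k + 1)) :=
    le_antisymm (hle.trans (LinearMap.range_pow_anti _ h)) (LinearMap.range_pow_anti _ k.le_succ)
  have h2 := index_range_quotientDelta_pow p hl.le
  rw [h1, index_range_quotientDelta_pow p hl] at h2
  exact absurd (Nat.pow_right_injective (Fact.out : p.Prime).two_le h2) (by omega)

/-- The generator of `M_{s-1} / M_s` used as the `p`-th power of the lift. -/
noncomputable def quotientSocle (r : ℕ) : UniserialLattice p ⧸ latticeSeries p (r + 2) :=
  (latticeSeries p (r + 2)).mkQ ((latticeDelta p ^ r) (latticeGen p))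

theorem quotientSocle_ne_zero (r : ℕ) : quotientSocle p r ≠ 0 := by
  intro h
  have h1 : (latticeDelta p ^ r) (latticeGen p) ∈ latticeSeries p (r + 2) :=
    (Submodule.Quotient.mk_eq_zero _).1 h
  rw [latticeSeries_succ] at h1
  exact latticeDelta_pow_gen_notMem p r h1

theorem quotientSocle_mem_range {k r : ℕ} (h : k ≤ r) :
    quotientSocle p r ∈ LinearMap.range ((quotientAlpha p (r + 2) - 1) ^ k) := by
  rw [range_quotientDelta_pow]
  exact Submodule.mem_map_of_mem (LinearMap.range_pow_anti _ h ⟨_, rfl⟩)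

theorem quotientDelta_socle (r : ℕ) :
    (quotientAlpha p (r + 2) - 1) (quotientSocle p r) = 0 := by
  rw [quotientSocle, ← quotientDelta_pow_mkQ, ← Module.End.mul_apply, ← pow_succ',
    quotientDelta_pow_eq_zero, LinearMap.zero_apply]

theorem quotientAlpha_socle (r : ℕ) :
    quotientAlpha p (r + 2) (quotientSocle p r) = quotientSocle p r :=
  sub_eq_zero.1 (quotientDelta_socle p r)

/-- The element is fixed by α, so the vanishing norm acts on it as p. -/
theorem prime_smul_socle (r : ℕ) : p • quotientSocle p r = 0 := by
  have h1 : ∀ k : ℕ, (quotientAlpha p (r + 2) ^ k) (quotientSocle p r) = quotientSocle p r := by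
    intro k
    induction k with
    | zero => rfl
    | succ k ih => rw [pow_succ', Module.End.mul_apply, ih, quotientAlpha_socle]
  have h2 := LinearMap.congr_fun (sum_quotientAlpha_pow p (r + 2)) (quotientSocle p r)
  rwa [LinearMap.sum_apply, Finset.sum_congr rfl fun k _ => h1 k, Finset.sum_const,
    Finset.card_range, LinearMap.zero_apply] at h2

theorem span_quotientSocle (r : ℕ) :
    Submodule.span ℤ_[p] {quotientSocle p r} =
      (latticeSeries p (r + 1)).map (latticeSeries p (r + 2)).mkQ := by
  rw [latticeSeries_succ p r, range_latticeDelta_pow_eq_sup, Submodule.map_sup,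
    ← latticeSeries_succ p (r + 1), Submodule.mkQ_map_self, sup_bot_eq, Submodule.map_span,
    Set.image_singleton]
  rfl

/-- The data of the non-split extension of `ℤ/p` by `M / M_{r+2}`. -/
noncomputable def latticeExtensionData (r : ℕ) :
    CyclicExtensionData p ℤ_[p] (UniserialLattice p ⧸ latticeSeries p (r + 2)) where
  α := quotientAlpha p (r + 2)
  z := quotientSocle p r
  pow_eq_one := quotientAlpha_pow_prime p (r + 2)
  map_z := quotientAlpha_socle p r

end QuotientExtension

/-! ### The group G and its invariants -/

open CyclicExtensionData Ext in
theorem isNonsplitLatticeExtension_latticeExtensionData (p : ℕ) [Fact p.Prime] (r : ℕ) :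
    IsNonsplitLatticeExtension p (r + 2) (latticeExtensionData p r).Ext := by
  refine ⟨extension _, y _, quotientSocle p r,
    isEmpty_splitting (sum_quotientAlpha_pow p _) (quotientSocle_ne_zero p r), rfl, fun x => ?_,
    span_quotientSocle p r, ?_⟩
  · refine (conj_y (D := latticeExtensionData p r) _).trans ?_
    exact congrArg (fun a => inl (latticeExtensionData p r) (Multiplicative.ofAdd a))
      (quotientAlpha_mkQ p (r + 2) x)
  · have h1 := pow_prime (D := latticeExtensionData p r) (sum_quotientAlpha_pow p (r + 2))
      (g := y _) (one_ne_zero (α := ZMod p))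
    have h2 : (y (latticeExtensionData p r)).right.val = 1 := ZMod.val_one p
    rw [h2, one_smul] at h1
    exact h1

open CyclicExtensionData Ext in
theorem nilpotencyClass_latticeExtension (p : ℕ) [Fact p.Prime] (r : ℕ) (hr : 0 < r) :
    Group.IsNilpotent (latticeExtensionData p r).Ext ∧
      Group.nilpotencyClass (latticeExtensionData p r).Ext = r + 1 := by
  have hbot : (⊤ : Subgroup (latticeExtensionData p r).Ext).lowerCentralSeries (r + 1) = ⊥ := by
    rw [lowerCentralSeries_succ_eq]
    exact (congrArg (fun f => embed (latticeExtensionData p r) (LinearMap.range f))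
      (quotientDelta_pow_eq_zero p (r + 1))).trans (by rw [LinearMap.range_zero, embed_bot])
  have hnil : Group.IsNilpotent (latticeExtensionData p r).Ext :=
    Subgroup.nilpotent_iff_lowerCentralSeries.2 ⟨_, hbot⟩
  refine ⟨hnil, le_antisymm (Subgroup.lowerCentralSeries_eq_bot_iff_nilpotencyClass_le.1 hbot) ?_⟩
  by_contra! hlt
  have h1 := Subgroup.lowerCentralSeries_eq_bot_iff_nilpotencyClass_le.2 (Nat.le_of_lt_succ hlt)
  rw [lowerCentralSeries_eq hr, ← embed_bot, le_antisymm_iff, embed_le_embed] at h1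
  exact not_range_quotientDelta_pow_le p r.lt_succ_self r.lt_succ_self (h1.1.trans bot_le)

open CyclicExtensionData Ext in
theorem theoremC (p : ℕ) [Fact p.Prime] (hp : Odd p) (s : ℕ) (hs : p + 1 ≤ s) :
    ∃ (G : Type) (_ : Group G),
      Finite G ∧ IsPGroup p G ∧
      Nat.card G = p ^ s ∧
      IsMaximalClass p G ∧
      (powerSubgroup G p ⊔ gammaTerm G (p - 1)).index = Nat.card (omegaSubgroup p 1 G) ∧
      (powerSubgroup G p ⊔ gammaTerm G (p - 1)).index = Nat.card (omegaSet p 1 G) ∧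
      ¬ gammaTerm G (p - 1) ≤ powerSubgroup G p ∧
      IsNonsplitLatticeExtension p s G := by
  have hp3 : 3 ≤ p := by
    have hp2 := (Fact.out : p.Prime).two_le
    obtain ⟨m, hm⟩ := hp
    omega
  obtain ⟨r, rfl⟩ : ∃ r, s = r + 2 := ⟨s - 2, by omega⟩
  let D := latticeExtensionData p r
  have hfin : Finite D.Ext := inferInstance
  have hcard : Nat.card D.Ext = p ^ (r + 2) := by
    rw [card_eq, card_quotient_latticeSeries, ← pow_succ]
  obtain ⟨hnil, hclass⟩ := nilpotencyClass_latticeExtension p r (by omega)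
  have hnorm : ∑ k ∈ Finset.range p, D.α ^ k = 0 := sum_quotientAlpha_pow p (r + 2)
  have hrange : LinearMap.range ((D.α - 1) ^ (p - 1)) =
      LinearMap.range (p : Module.End ℤ_[p] (UniserialLattice p ⧸ latticeSeries p (r + 2))) :=
    range_quotientDelta_pow_prime p (r + 2)
  have hpow : powerSubgroup D.Ext p = embed D (LinearMap.range ((D.α - 1) ^ (p - 1))) := by
    rw [powerSubgroup_eq hnorm, ← hrange]
    rw [← hrange]
    -- Here s ≥ p + 1 is essential: z has depth r = s − 2, which must be at least p − 1.
    exact quotientSocle_mem_range p (by omega)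
  have hgamma : gammaTerm D.Ext (p - 1) = embed D (LinearMap.range ((D.α - 1) ^ (p - 1 - 1))) :=
    -- Oddness enters here: p − 2 > 0 places γ_(p−1)(G) inside the kernel.
    lowerCentralSeries_eq (by omega)
  have hsup : (powerSubgroup D.Ext p ⊔ gammaTerm D.Ext (p - 1)).index = p ^ (p - 1) := by
    have hle := embed_le_embed (D := D).2
      (LinearMap.range_pow_anti (D.α - 1) (Nat.sub_le (p - 1) 1))
    rw [hpow, hgamma, sup_eq_right.2 hle, index_embed]
    refine (congrArg (p * ·) (index_range_quotientDelta_pow p (by omega))).trans ?_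
    exact mul_pow_sub_one (by omega) p
  have homega : omegaSet p 1 D.Ext = embed D (LinearMap.ker
      (p : Module.End ℤ_[p] (UniserialLattice p ⧸ latticeSeries p (r + 2)))) :=
    omegaSet_eq hnorm (quotientSocle_ne_zero p r) (prime_smul_socle p r)
  have hker : Nat.card (embed D (LinearMap.ker
      (p : Module.End ℤ_[p] (UniserialLattice p ⧸ latticeSeries p (r + 2))))) = p ^ (p - 1) := by
    set f := (p : Module.End ℤ_[p] (UniserialLattice p ⧸ latticeSeries p (r + 2)))
    -- In a finite group the kernel of an endomorphism has order equal to the index of its image.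
    have h1 := AddSubgroup.card_mul_index f.toAddMonoidHom.ker
    rw [AddSubgroup.index_ker, ← AddSubgroup.card_mul_index f.toAddMonoidHom.range, mul_comm] at h1
    have h2 := Nat.eq_of_mul_eq_mul_left Nat.card_pos h1
    rw [card_embed]
    refine Eq.trans h2 ?_
    have h3 : f.toAddMonoidHom.range =
        (LinearMap.range ((D.α - 1) ^ (p - 1))).toAddSubgroup := by
      rw [hrange]; rfl
    rw [h3]
    exact index_range_quotientDelta_pow p (by omega)
  refine ⟨D.Ext, inferInstance, hfin, IsPGroup.of_card hcard, hcard,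
    ⟨r + 2, by omega, hcard, hnil, hclass⟩, ?_, ?_, ?_,
    isNonsplitLatticeExtension_latticeExtensionData p r⟩
  · rw [hsup, omegaSubgroup, homega, Subgroup.closure_eq, hker]
  · rw [hsup, homega]
    exact hker.symm
  · rw [hpow, hgamma, embed_le_embed]
    exact not_range_quotientDelta_pow_le p (by omega) (by omega)
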